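/- **Theorem 3.6 (existence of $\mathbf\Sigma^1_n$- and $\mathbf\Pi^1_n$-complete tall ideals).** An *ideal* on $\omega$ is a family $\mathcal I\subseteq\mathcal P(\omega)$ that contains all finite sets, is closed under subsets and finite unions, and does not contain $\omega$; it is *tall* if every infinite $X\subseteq\omega$ contains an infinite element of $\mathcal I$. The space $\mathcal P(\omega)\simeq 2^\omega$ carries its usual compact Polish topology. For a class $\Gamma$ ($=\mathbf\Sigma^1_n$ or $\mathbf\Pi^1_n$, the boldface projective classes), a subset $B$ of a Polish space $Y$ is *$\Gamma$-complete* if $B$ belongs to $\Gamma$ and for every $\Gamma$ subset $A$ of a zero-dimensional Polish space $X$ there is a continuous $f:X\to Y$ with $f^{-1}(B)=A$. For every $n\ge 1$ and for each of $\Gamma=\mathbf\Sigma^1_n$ and $\Gamma=\mathbf\Pi^1_n$ there exist a tall Borel ideal $\mathcal J$ on $\omega$, a nonempty perfect (i.e. closed without isolated points) family $\mathcal A\subseteq\mathcal P(\omega)\setminus\mathcal J$ such that $A\cap B$ is finite for all distinct $A,B\in\mathcal A$, and a $\Gamma$-complete subset $\mathcal B$ of the Polish space $\mathcal A$, such that the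 ideal generated by $\mathcal J\cup\mathcal B$, that is, $$\Big\{X\subseteq\omega:\ X\setminus\textstyle\bigcup\mathcal F\text{ is finite for some finite }\mathcal F\subseteq\mathcal J\cup\mathcal B\Big\},$$ is a (proper) tall ideal on $\omega$ and is a $\Gamma$-complete subset of $\mathcal P(\omega)$. In particular, for every $n\geq 1$ there exist $\mathbf\Sigma^1_n$-complete tall ideals and $\mathbf\Pi^1_n$-complete tall ideals on $\omega$. -/

import Mathlib

open Set Topology TopologicalSpace

/-- The usual compact Polish topology on `𝒫(ω)`, transported from the Cantor space `2^ω` along the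
identification of a set with its characteristic function. -/
noncomputable instance powerSetTopology : TopologicalSpace (Set ℕ) :=
  TopologicalSpace.induced (fun A : Set ℕ => (A.boolIndicator : ℕ → Bool)) inferInstance

/-- `s` is Borel for the given topology. -/
def IsBorel {X : Type} [TopologicalSpace X] (s : Set X) : Prop :=
  @MeasurableSet X (borel X) s

/-- The boldface projective classes `Σ¹ₙ`, `n ≥ 1`, in a Polish space `X`. A set is `Σ¹ₙ₊₁` if it is
the projection along the Baire space of a `Π¹ₙ` subset of `X × ω^ω`, where `Π¹ₙ` means that the
complement is `Σ¹ₙ`. The recursion is started with the Borel sets at the auxiliary level `0`, so that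
level `1` consists of the analytic sets (`isSigmaOne_one_iff` below). -/
def IsSigmaOne : ℕ → ∀ {X : Type} [TopologicalSpace X], Set X → Prop
  | 0, _, _, s => IsBorel s
  | n + 1, X, _, s => ∃ t : Set (X × (ℕ → ℕ)), IsSigmaOne n tᶜ ∧ s = Prod.fst '' t

/-- The boldface projective classes `Π¹ₙ`: complements of `Σ¹ₙ` sets. -/
def IsPiOne (n : ℕ) {X : Type} [TopologicalSpace X] (s : Set X) : Prop :=
  IsSigmaOne n sᶜ

theorem isSigmaOne_one_iff {X : Type} [TopologicalSpace X] [PolishSpace X] (s : Set X) :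
    IsSigmaOne 1 s ↔ MeasureTheory.AnalyticSet s := by
  constructor
  · rintro ⟨t, ht, rfl⟩
    let _ : MeasurableSpace (X × (ℕ → ℕ)) := borel _
    have : BorelSpace (X × (ℕ → ℕ)) := ⟨rfl⟩
    have ht' : MeasurableSet t := MeasurableSet.of_compl ht
    exact ht'.analyticSet.image_of_continuous continuous_fst
  · intro h
    rw [MeasureTheory.AnalyticSet] at h
    rcases h with rfl | ⟨f, hf, rfl⟩
    · refine ⟨∅, ?_, by simp⟩
      let _ : MeasurableSpace (X × (ℕ → ℕ)) := borel _
      exact MeasurableSet.compl MeasurableSet.empty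
    · refine ⟨{p | f p.2 = p.1}, ?_, ?_⟩
      · let _ : MeasurableSpace (X × (ℕ → ℕ)) := borel _
        have : BorelSpace (X × (ℕ → ℕ)) := ⟨rfl⟩
        exact (isClosed_eq (hf.comp continuous_snd) continuous_fst).measurableSet.compl
      · ext x
        constructor
        · rintro ⟨y, rfl⟩
          exact ⟨(f y, y), rfl, rfl⟩
        · rintro ⟨⟨_, y⟩, h, rfl⟩
          exact ⟨y, h⟩

/-- `B ⊆ Y` is hard for the pointclass `Γ`: every set in `Γ` of a zero-dimensional Polish space is a
continuous preimage of `B`. (Every Polish space is homeomorphic to one whose points form a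
`Type`.) -/
def IsHardFor (Γ : ∀ {X : Type} [TopologicalSpace X], Set X → Prop)
    {Y : Type} [TopologicalSpace Y] (B : Set Y) : Prop :=
  ∀ (X : Type) [TopologicalSpace X] [PolishSpace X],
    IsTopologicalBasis {U : Set X | IsClopen U} →
      ∀ A : Set X, Γ A → ∃ f : X → Y, Continuous f ∧ f ⁻¹' B = A

/-- `B ⊆ Y` is complete for the pointclass `Γ`: it belongs to `Γ` and is hard for `Γ`. -/
def IsCompleteFor (Γ : ∀ {X : Type} [TopologicalSpace X], Set X → Prop)
    {Y : Type} [TopologicalSpace Y] (B : Set Y) : Prop :=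
  Γ B ∧ IsHardFor Γ B

/-- A (proper) ideal on `ω` containing all finite sets. -/
structure IsIdealOnOmega (I : Set (Set ℕ)) : Prop where
  fin_mem : ∀ A : Set ℕ, A.Finite → A ∈ I
  subset_mem : ∀ A B : Set ℕ, A ⊆ B → B ∈ I → A ∈ I
  union_mem : ∀ A B : Set ℕ, A ∈ I → B ∈ I → A ∪ B ∈ I
  univ_notMem : (univ : Set ℕ) ∉ I

/-- Every infinite subset of `ω` contains an infinite element of `I`. -/
def IsTall (I : Set (Set ℕ)) : Prop :=
  ∀ X : Set ℕ, X.Infinite → ∃ A ∈ I, A ⊆ X ∧ A.Infinite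

/-- The ideal generated by `H` (and the finite sets): all sets covered, up to a finite set, by
finitely many members of `H`. -/
def generatedIdeal (H : Set (Set ℕ)) : Set (Set ℕ) :=
  {X | ∃ F : Set (Set ℕ), F.Finite ∧ F ⊆ H ∧ (X \ ⋃₀ F).Finite}

/-- A nonempty family of `J`-positive sets with pairwise finite intersections, i.e. a
`(J, Fin)`-almost disjoint family. If `J` contains the finite sets, it is in particular an almost
disjoint family of infinite sets and a `J`-almost disjoint family. -/
structure IsPositiveADFamily (J 𝒜 : Set (Set ℕ)) : Prop where
  nonempty : 𝒜.Nonempty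
  positive : ∀ A ∈ 𝒜, A ∉ J
  inter_finite : ∀ A ∈ 𝒜, ∀ B ∈ 𝒜, A ≠ B → (A ∩ B).Finite

/-! Work on the binary tree, with node weight 1/(length + 1). Weights tend to 0, so the summable
ideal J is tall; it is also F_σ. A branch has one node on every level, so its weight dominates the
harmonic series and it is J-positive, while distinct branches share finitely many nodes. The
branches form a perfect family homeomorphic to Cantor space.

Let B be a complete set of branches, obtained from a universal set, and I_B the ideal generated by J
and B. A branch outside B meets every finite union from B in a finite set, so it lies in I_B only if
it is in J, which is impossible. Hence B is the trace of I_B on the branches, and I_B is hard.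

For the upper bound, "finitely many members of B cover X modulo J" is a projection, which suffices
for Σ. For Π, `IsPositiveADFamily.mem_generatedIdeal_iff_forall` replaces it by a universal
condition: X lies in the ideal of all branches, and each branch meeting X in a J-positive set is in
B. The first clause is Borel since J is F_σ and Cantor space is compact. -/

/-! ### Closure properties and complete sets of the projective classes. -/

section ProjectiveClasses

variable {X Y : Type} [TopologicalSpace X] [TopologicalSpace Y]

theorem IsBorel.preimage {s : Set Y} (hs : IsBorel s) {f : X → Y} (hf : Continuous f) :
    IsBorel (f ⁻¹' s) := by
  let _ : MeasurableSpace X := borel X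
  have : BorelSpace X := ⟨rfl⟩
  let _ : MeasurableSpace Y := borel Y
  have : BorelSpace Y := ⟨rfl⟩
  exact hf.measurable hs

theorem IsSigmaOne.preimage {n : ℕ} {s : Set Y} (hs : IsSigmaOne n s) {f : X → Y}
    (hf : Continuous f) : IsSigmaOne n (f ⁻¹' s) := by
  induction n generalizing X Y with
  | zero => exact IsBorel.preimage hs hf
  | succ n ih =>
    obtain ⟨t, ht, rfl⟩ := hs
    refine ⟨Prod.map f id ⁻¹' t, ih ht (hf.prodMap continuous_id), ?_⟩
    ext x
    simp

theorem IsPiOne.preimage {n : ℕ} {s : Set Y} (hs : IsPiOne n s) {f : X → Y}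
    (hf : Continuous f) : IsPiOne n (f ⁻¹' s) :=
  IsSigmaOne.preimage (s := sᶜ) hs hf

theorem IsPiOne.isSigmaOne_succ {n : ℕ} {s : Set X} (hs : IsPiOne n s) :
    IsSigmaOne (n + 1) s := by
  refine ⟨Prod.fst ⁻¹' s, IsPiOne.preimage hs continuous_fst, ?_⟩
  rw [image_preimage_eq _ Prod.fst_surjective]

theorem IsBorel.compl {s : Set X} (hs : IsBorel s) : IsBorel sᶜ :=
  @MeasurableSet.compl _ _ (borel X) hs

theorem IsBorel.isSigmaOne {s : Set X} (hs : IsBorel s) (n : ℕ) : IsSigmaOne n s := by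
  induction n generalizing s with
  | zero => exact hs
  | succ n ih => exact IsPiOne.isSigmaOne_succ (ih hs.compl)

theorem IsClosed.isBorel {s : Set X} (hs : IsClosed s) : IsBorel s := by
  let _ : MeasurableSpace X := borel X
  have : BorelSpace X := ⟨rfl⟩
  exact hs.measurableSet

theorem IsBorel.iUnion {ι : Type} [Countable ι] {s : ι → Set X} (hs : ∀ i, IsBorel (s i)) :
    IsBorel (⋃ i, s i) :=
  @MeasurableSet.iUnion _ _ (borel X) _ _ hs

/-- The two claims are proved together because the union step at level n + 1 uses both of them at
level n. -/
theorem isSigmaOne_iUnion_iInter (n : ℕ) (s : ℕ → Set X) (hs : ∀ i, IsSigmaOne n (s i)) :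
    IsSigmaOne n (⋃ i, s i) ∧ IsSigmaOne n (⋂ i, s i) := by
  induction n generalizing X with
  | zero => exact ⟨IsBorel.iUnion hs, @MeasurableSet.iInter _ _ (borel X) _ _ hs⟩
  | succ n ih =>
    choose t ht hst using hs
    constructor
    -- Coordinate 0 of the witness names the index i; the shifted tail is a witness for `s i`.
    · let g : X × (ℕ → ℕ) → X × (ℕ → ℕ) := fun p => (p.1, fun j => p.2 (j + 1))
      have hg : Continuous g := by fun_prop
      let c : ℕ → Set (X × (ℕ → ℕ)) := fun i => {p | p.2 0 ≠ i}
      have hc : ∀ i, IsSigmaOne n (c i) := by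
        intro i
        have h : Continuous fun p : X × (ℕ → ℕ) => p.2 0 := by fun_prop
        exact IsBorel.isSigmaOne ((isClosed_discrete {k : ℕ | k ≠ i}).preimage h).isBorel n
      refine ⟨{p | g p ∈ t (p.2 0)}, ?_, ?_⟩
      · have : {p | g p ∈ t (p.2 0)}ᶜ =
            ⋂ i, ⋃ k : ℕ, if k = 0 then c i else g ⁻¹' (t i)ᶜ := by
          ext p
          simp only [mem_compl_iff, mem_ofPred_eq, mem_iInter, mem_iUnion]
          constructor
          · intro h i
            by_cases hi : p.2 0 = i
            · exact ⟨1, by subst hi; simpa using h⟩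
            · exact ⟨0, by simpa [c] using hi⟩
          · intro h
            obtain ⟨k, hk⟩ := h (p.2 0)
            split_ifs at hk with h0
            · exact absurd rfl hk
            · exact hk
        rw [this]
        refine (ih _ fun i => (ih _ fun k => ?_).1).2
        split_ifs
        exacts [hc i, (ht i).preimage hg]
      · ext x
        simp only [hst, mem_iUnion, mem_image, Prod.exists, exists_and_right, exists_eq_right,
          mem_ofPred_eq]
        constructor
        · rintro ⟨i, y, hy⟩
          exact ⟨fun j => Nat.casesOn j i y, hy⟩
        · rintro ⟨y, hy⟩
          exact ⟨_, _, hy⟩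
    -- One sequence codes witnesses for all i through the pairing function.
    · let g : ℕ → X × (ℕ → ℕ) → X × (ℕ → ℕ) := fun i p => (p.1, fun j => p.2 (Nat.pair i j))
      have hg : ∀ i, Continuous (g i) := fun i => by fun_prop
      refine ⟨⋂ i, g i ⁻¹' t i, ?_, ?_⟩
      · rw [compl_iInter]
        exact (ih _ fun i => (ht i).preimage (hg i)).1
      · ext x
        simp only [hst, mem_iInter, mem_image, Prod.exists, exists_and_right, exists_eq_right,
          mem_preimage]
        constructor
        · intro h
          choose y hy using h
          refine ⟨fun j => y j.unpair.1 j.unpair.2, fun i => ?_⟩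
          simpa [g] using hy i
        · rintro ⟨y, hy⟩ i
          exact ⟨_, hy i⟩

theorem IsSigmaOne.iUnion {n : ℕ} {s : ℕ → Set X} (hs : ∀ i, IsSigmaOne n (s i)) :
    IsSigmaOne n (⋃ i, s i) :=
  (isSigmaOne_iUnion_iInter n s hs).1

theorem IsSigmaOne.iInter {n : ℕ} {s : ℕ → Set X} (hs : ∀ i, IsSigmaOne n (s i)) :
    IsSigmaOne n (⋂ i, s i) :=
  (isSigmaOne_iUnion_iInter n s hs).2

theorem IsSigmaOne.inter {n : ℕ} {s t : Set X} (hs : IsSigmaOne n s) (ht : IsSigmaOne n t) :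
    IsSigmaOne n (s ∩ t) := by
  have : s ∩ t = ⋂ k : ℕ, if k = 0 then s else t := by
    ext x
    simp only [mem_inter_iff, mem_iInter]
    refine ⟨fun h k => by split_ifs; exacts [h.1, h.2], fun h => ⟨by simpa using h 0, by
      simpa using h 1⟩⟩
  rw [this]
  exact IsSigmaOne.iInter fun k => by split_ifs <;> assumption

theorem IsSigmaOne.union {n : ℕ} {s t : Set X} (hs : IsSigmaOne n s) (ht : IsSigmaOne n t) :
    IsSigmaOne n (s ∪ t) := by
  have : s ∪ t = ⋃ k : ℕ, if k = 0 then s else t := by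
    ext x
    simp only [mem_union, mem_iUnion]
    constructor
    · rintro (h | h)
      exacts [⟨0, by simpa using h⟩, ⟨1, by simpa using h⟩]
    · rintro ⟨k, hk⟩
      split_ifs at hk
      exacts [Or.inl hk, Or.inr hk]
  rw [this]
  exact IsSigmaOne.iUnion fun k => by split_ifs <;> assumption

/-- `Σ¹ₙ₊₁` is closed under projections along Polish spaces. -/
theorem IsSigmaOne.image_fst {n : ℕ} {Z : Type} [TopologicalSpace Z] [PolishSpace Z]
    {s : Set (X × Z)} (hs : IsSigmaOne (n + 1) s) : IsSigmaOne (n + 1) (Prod.fst '' s) := by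
  rcases isEmpty_or_nonempty Z with hZ | hZ
  · rw [eq_empty_of_isEmpty s, image_empty]
    exact IsBorel.isSigmaOne isClosed_empty.isBorel _
  · obtain ⟨φ, hφ, hsurj⟩ := PolishSpace.exists_nat_nat_continuous_surjective Z
    obtain ⟨t, ht, rfl⟩ := hs
    -- Even coordinates code the point of Z, odd ones the old witness.
    let g : X × (ℕ → ℕ) → (X × Z) × (ℕ → ℕ) := fun p =>
      ((p.1, φ fun j => p.2 (2 * j)), fun j => p.2 (2 * j + 1))
    have hg : Continuous g := by fun_prop
    refine ⟨g ⁻¹' t, ht.preimage hg, ?_⟩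
    ext x
    simp only [mem_image, Prod.exists, exists_and_right, exists_eq_right, mem_preimage]
    constructor
    · rintro ⟨z, y, h⟩
      obtain ⟨u, rfl⟩ := hsurj z
      refine ⟨fun j => if j % 2 = 0 then u (j / 2) else y (j / 2), ?_⟩
      convert h using 4 with j j <;> simp [Nat.add_div]
    · rintro ⟨y, h⟩
      exact ⟨_, _, h⟩

/-- `Σ¹ₙ₊₁` is closed under continuous images of Polish spaces. -/
theorem IsSigmaOne.image {n : ℕ} [T2Space Y] [PolishSpace X] {s : Set X}
    (hs : IsSigmaOne (n + 1) s) {f : X → Y} (hf : Continuous f) :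
    IsSigmaOne (n + 1) (f '' s) := by
  have : f '' s = Prod.fst '' ({p : Y × X | f p.2 = p.1} ∩ Prod.snd ⁻¹' s) := by
    ext y
    simp only [mem_image, mem_inter_iff, mem_ofPred_eq, mem_preimage, Prod.exists, exists_and_right,
      exists_eq_right]
    exact exists_congr fun _ => and_comm
  rw [this]
  exact IsSigmaOne.image_fst (((isClosed_eq (hf.comp continuous_snd)
    continuous_fst).isBorel.isSigmaOne _).inter (hs.preimage continuous_snd))

/-- Existence of universal `Σ¹ₙ₊₁` sets. -/
theorem exists_universal_isSigmaOne (n : ℕ) (X : Type) [TopologicalSpace X] [PolishSpace X] :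
    ∃ U : Set ((ℕ → Bool) × X), IsSigmaOne (n + 1) U ∧
      ∀ s : Set X, IsSigmaOne (n + 1) s → ∃ c, s = {x | (c, x) ∈ U} := by
  induction n generalizing X with
  | zero =>
    obtain ⟨b, hb⟩ : ∃ b : ℕ → Set (X × (ℕ → ℕ)), IsTopologicalBasis (range b) := by
      obtain ⟨B, hBc, -, hB⟩ := exists_countable_basis (X × (ℕ → ℕ))
      have hB' : IsTopologicalBasis (insert ∅ B) :=
        hB.insert_empty
      obtain ⟨b, hb⟩ := (hBc.insert ∅).exists_eq_range (insert_nonempty _ _)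
      exact ⟨b, hb ▸ hB'⟩
    -- The parameter selects basic open sets to delete, so the sections of U are exactly the closed
    -- sets.
    let U : Set (((ℕ → Bool) × X) × (ℕ → ℕ)) :=
      {p | ∀ i, p.1.1 i = false ∨ (p.1.2, p.2) ∈ (b i)ᶜ}
    have hU : IsClosed U := by
      have : U = ⋂ i, ({p | p.1.1 i = false} ∪ {p | (p.1.2, p.2) ∈ (b i)ᶜ}) := by
        ext p
        simp [U]
      rw [this]
      refine isClosed_iInter fun i => IsClosed.union (isClosed_eq (by fun_prop) (by fun_prop)) ?_
      exact (hb.isOpen ⟨i, rfl⟩).isClosed_compl.preimage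
        (f := fun p : ((ℕ → Bool) × X) × (ℕ → ℕ) => (p.1.2, p.2)) (by fun_prop)
    refine ⟨Prod.fst '' U, ⟨U, hU.isBorel.compl, rfl⟩, fun s hs => ?_⟩
    -- Being analytic, s is the projection of a closed set, not merely of a Borel one.
    obtain ⟨F, hF, rfl⟩ : ∃ F : Set (X × (ℕ → ℕ)), IsClosed F ∧ s = Prod.fst '' F := by
      rw [isSigmaOne_one_iff, MeasureTheory.AnalyticSet] at hs
      rcases hs with rfl | ⟨f, hf, rfl⟩
      · exact ⟨∅, isClosed_empty, by simp⟩
      · refine ⟨{p | f p.2 = p.1}, isClosed_eq (by fun_prop) (by fun_prop), ?_⟩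
        ext x
        simp
    classical
    refine ⟨fun i => decide (b i ⊆ Fᶜ), ?_⟩
    ext x
    simp only [mem_image, Prod.exists, exists_and_right, exists_eq_right, mem_ofPred_eq]
    refine exists_congr fun y => ⟨fun h i => ?_, fun h => ?_⟩
    · by_cases hi : b i ⊆ Fᶜ
      · exact Or.inr fun h' => hi h' h
      · exact Or.inl (by simpa using hi)
    · by_contra hxy
      obtain ⟨_, ⟨i, rfl⟩, hi, hiF⟩ := hb.exists_subset_of_mem_open hxy hF.isOpen_compl
      rcases h i with h | h
      · simp [hiF] at h
      · exact h hi
  | succ n ih =>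
    obtain ⟨U, hU, huniv⟩ := ih (X × (ℕ → ℕ))
    refine ⟨Prod.fst '' (Homeomorph.prodAssoc (ℕ → Bool) X (ℕ → ℕ) ⁻¹' Uᶜ),
      ⟨_, ?_, rfl⟩, ?_⟩
    · rw [← preimage_compl, compl_compl]
      exact hU.preimage (Homeomorph.continuous _)
    · rintro _ ⟨t, ht, rfl⟩
      obtain ⟨c, hc⟩ := huniv _ ht
      refine ⟨c, ?_⟩
      ext x
      simp only [mem_image, Prod.exists, exists_and_right, exists_eq_right, mem_ofPred_eq]
      refine exists_congr fun y => ?_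
      have := Set.ext_iff.1 hc (x, y)
      simp only [mem_compl_iff, mem_ofPred_eq] at this
      rw [← not_iff_not, this]
      simp [Homeomorph.prodAssoc]

/-- A zero-dimensional second countable Hausdorff space injects continuously into Cantor space. -/
theorem exists_continuous_injective_cantor [T2Space X] [SecondCountableTopology X]
    (hX : IsTopologicalBasis {U : Set X | IsClopen U}) :
    ∃ e : X → (ℕ → Bool), Continuous e ∧ Function.Injective e := by
  obtain ⟨B, hBX, hBc, hB⟩ := hX.exists_countable
  have hBX' : ∀ U ∈ insert ∅ B, IsClopen U := by
    rintro U (rfl | h)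
    exacts [isClopen_empty, hBX h]
  obtain ⟨b, hb⟩ := (hBc.insert ∅).exists_eq_range (insert_nonempty _ _)
  have hclopen : ∀ i, IsClopen (b i) := fun i => hBX' _ (hb ▸ mem_range_self i)
  refine ⟨fun x i => (b i).boolIndicator x, continuous_pi fun i =>
    (continuous_boolIndicator_iff_isClopen _).2 (hclopen i), fun x y hxy => ?_⟩
  by_contra hne
  obtain ⟨U, hU, hxU, hyU⟩ := hB.exists_subset_of_mem_open (show x ∈ ({y} : Set X)ᶜ from hne)
    isOpen_compl_singleton
  obtain ⟨i, rfl⟩ : U ∈ range b := hb ▸ mem_insert_of_mem _ hU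
  have h : (b i).boolIndicator x = (b i).boolIndicator y := congrFun hxy i
  rw [(mem_iff_boolIndicator _ _).1 hxU] at h
  exact hyU ((mem_iff_boolIndicator _ _).2 h.symm) rfl

instance polishSpace_pi_discrete {ι κ : Type} [Countable ι] [Countable κ] [TopologicalSpace κ]
    [DiscreteTopology κ] : PolishSpace (ι → κ) :=
  have : IsCompletelyMetrizableSpace (ι → κ) := IsCompletelyMetrizableSpace.pi_countable
  inferInstance

/-- A universal set is hard: inject X by e into Cantor space, let c code the image of A, and reduce
by x ↦ (c, e x). Injectivity of e recovers A from its image. -/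
theorem exists_isCompleteFor_isSigmaOne (n : ℕ) :
    ∃ B : Set (ℕ → Bool), IsCompleteFor (IsSigmaOne (n + 1)) B := by
  obtain ⟨U, hU, huniv⟩ := exists_universal_isSigmaOne n (ℕ → Bool)
  let φ : (ℕ → Bool) ≃ₜ (ℕ → Bool) × (ℕ → Bool) :=
    (Homeomorph.piCongrLeft (Y := fun _ => Bool) Equiv.natSumNatEquivNat).symm.trans
      Homeomorph.sumArrowHomeomorphProdArrow
  refine ⟨φ ⁻¹' U, hU.preimage φ.continuous, fun X _ _ hX A hA => ?_⟩
  obtain ⟨e, he, hinj⟩ := exists_continuous_injective_cantor hX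
  obtain ⟨c, hc⟩ := huniv _ (hA.image he)
  refine ⟨fun x => φ.symm (c, e x), φ.symm.continuous.comp (by fun_prop), ?_⟩
  ext x
  have := Set.ext_iff.1 hc (e x)
  simp only [mem_ofPred_eq, hinj.mem_set_image] at this
  simp [this]

theorem IsHardFor.compl {n : ℕ} {B : Set Y} (hB : IsHardFor (IsSigmaOne n) B) :
    IsHardFor (IsPiOne n) Bᶜ := fun X _ _ hX A hA => by
  obtain ⟨f, hf, h⟩ := hB X hX Aᶜ hA
  exact ⟨f, hf, by rw [preimage_compl, h, compl_compl]⟩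

theorem IsCompleteFor.compl {n : ℕ} {B : Set Y} (hB : IsCompleteFor (IsSigmaOne n) B) :
    IsCompleteFor (IsPiOne n) Bᶜ :=
  ⟨show IsSigmaOne n Bᶜᶜ by rw [compl_compl]; exact hB.1, hB.2.compl⟩

theorem IsHardFor.of_preimage {Γ : ∀ {X : Type} [TopologicalSpace X], Set X → Prop} {B : Set X}
    (hB : IsHardFor Γ B) {g : X → Y} (hg : Continuous g) {D : Set Y} (h : g ⁻¹' D = B) :
    IsHardFor Γ D := fun Z _ _ hZ A hA => by
  obtain ⟨f, hf, rfl⟩ := hB Z hZ A hA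
  exact ⟨g ∘ f, hg.comp hf, by rw [preimage_comp, h]⟩

end ProjectiveClasses

/-! ### The topology of the power set. -/

section PowerSet

variable {X : Type} [TopologicalSpace X]

theorem continuous_powerSet_iff {f : X → Set ℕ} :
    Continuous f ↔ ∀ m, IsClopen {x | m ∈ f x} := by
  rw [continuous_induced_rng, continuous_pi_iff]
  refine forall_congr' fun m => ?_
  rw [← continuous_boolIndicator_iff_isClopen]
  refine iff_of_eq (congrArg _ ?_)
  funext x
  rfl

theorem isClopen_setOf_mem (m : ℕ) : IsClopen {A : Set ℕ | m ∈ A} :=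
  continuous_powerSet_iff.1 continuous_id m

instance : T2Space (Set ℕ) :=
  T2Space.of_injective_continuous (f := fun A : Set ℕ => (A.boolIndicator : ℕ → Bool))
    (fun A B h => by
      ext m
      rw [mem_iff_boolIndicator, mem_iff_boolIndicator]
      exact iff_of_eq (congrArg (· = true) (congrFun h m)))
    continuous_induced_dom

end PowerSet

/-! ### Summable ideals: tallness and Borel complexity. -/

section SummableIdeal

/-- The summable ideal of a weight function on `ω`. -/
def summableIdeal (w : ℕ → ℝ) : Set (Set ℕ) := {A | Summable (A.indicator w)}

variable {w : ℕ → ℝ}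

theorem summableIdeal_of_finite {A : Set ℕ} (hA : A.Finite) : A ∈ summableIdeal w :=
  summable_of_hasFiniteSupport (hA.subset support_indicator_subset)

theorem summableIdeal_mono (hw : ∀ m, 0 ≤ w m) {A B : Set ℕ} (hAB : A ⊆ B)
    (hB : B ∈ summableIdeal w) : A ∈ summableIdeal w :=
  Summable.of_nonneg_of_le (indicator_nonneg fun m _ => hw m)
    (indicator_le_indicator_of_subset hAB hw) hB

theorem summableIdeal_union (hw : ∀ m, 0 ≤ w m) {A B : Set ℕ} (hA : A ∈ summableIdeal w)
    (hB : B ∈ summableIdeal w) : A ∪ B ∈ summableIdeal w := by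
  rw [← union_sdiff_self]
  have h : Summable ((B \ A).indicator w) := summableIdeal_mono hw sdiff_subset hB
  have := Summable.add hA h
  rwa [← indicator_union_of_disjoint disjoint_sdiff_right] at this

theorem isIdealOnOmega_summableIdeal (hw : ∀ m, 0 ≤ w m) (h : univ ∉ summableIdeal w) :
    IsIdealOnOmega (summableIdeal w) where
  fin_mem _ := summableIdeal_of_finite
  subset_mem _ _ := summableIdeal_mono hw
  union_mem _ _ := summableIdeal_union hw
  univ_notMem := h

theorem isTall_summableIdeal (hw : ∀ m, 0 ≤ w m) (h : Filter.Tendsto w Filter.atTop (𝓝 0)) :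
    IsTall (summableIdeal w) := by
  intro X hX
  -- Thin X out so that the n-th chosen point has weight at most 2⁻ⁿ.
  obtain ⟨φ, hφ, hP⟩ := Filter.extraction_forall_of_frequently
    (P := fun n k => k ∈ X ∧ w k ≤ (1 / 2 : ℝ) ^ n) fun n =>
      (Nat.frequently_atTop_iff_infinite.2 hX).and_eventually
        (h.eventually (ge_mem_nhds (by positivity : (0 : ℝ) < (1 / 2) ^ n)))
  refine ⟨range φ, ?_, range_subset_iff.2 fun n => (hP n).1,
    infinite_range_of_injective hφ.injective⟩
  refine (hφ.injective.summable_iff fun m hm => indicator_of_notMem hm w).1 ?_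
  refine Summable.of_nonneg_of_le (fun n => indicator_nonneg (fun m _ => hw m) _) (fun n => ?_)
    summable_geometric_two
  simpa using (hP n).2

/-- The sets whose finite subsets have total weight at most `N`. -/
def boundedWeight (w : ℕ → ℝ) (N : ℕ) : Set (Set ℕ) :=
  {A | ∀ F : Finset ℕ, ∑ m ∈ F, A.indicator w m ≤ N}

theorem isClosed_boundedWeight (w : ℕ → ℝ) (N : ℕ) : IsClosed (boundedWeight w N) := by
  have : boundedWeight w N =
      ⋂ F : Finset ℕ, {A | ∑ m ∈ F, A.indicator w m ≤ (N : ℝ)} := by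
    ext A
    simp [boundedWeight]
  rw [this]
  refine isClosed_iInter fun F => isClosed_le (continuous_finsetSum _ fun m _ => ?_)
    continuous_const
  exact (continuous_const (y := w m)).indicator (s := {A : Set ℕ | m ∈ A}) (by
    simp [(isClopen_setOf_mem m).frontier_eq])

/-- This F_σ form is what the compactness argument in `isBorel_generatedIdeal_range` needs. -/
theorem summableIdeal_eq_iUnion (hw : ∀ m, 0 ≤ w m) :
    summableIdeal w = ⋃ N, boundedWeight w N := by
  ext A
  have hA : ∀ m, 0 ≤ A.indicator w m := indicator_nonneg fun m _ => hw m
  rw [mem_iUnion]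
  constructor
  · intro h
    obtain ⟨N, hN⟩ := exists_nat_ge (∑' m, A.indicator w m)
    exact ⟨N, fun F => (h.sum_le_tsum F fun m _ => hA m).trans hN⟩
  · rintro ⟨N, hN⟩
    exact summable_of_sum_le hA hN

theorem isBorel_summableIdeal (hw : ∀ m, 0 ≤ w m) : IsBorel (summableIdeal w) := by
  rw [summableIdeal_eq_iUnion hw]
  exact IsBorel.iUnion fun N => (isClosed_boundedWeight w N).isBorel

end SummableIdeal

/-! ### Ideals generated over J by almost disjoint families. -/

section GeneratedIdeal

variable {J : Set (Set ℕ)}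

theorem subset_generatedIdeal (H : Set (Set ℕ)) : H ⊆ generatedIdeal H := fun A hA =>
  ⟨{A}, finite_singleton A, singleton_subset_iff.2 hA, by simp⟩

theorem IsIdealOnOmega.sUnion_mem (hJ : IsIdealOnOmega J) {F : Set (Set ℕ)} (hF : F.Finite)
    (h : F ⊆ J) : ⋃₀ F ∈ J := by
  induction F, hF using Set.Finite.induction_on with
  | empty => exact hJ.fin_mem _ (by simp)
  | insert _ _ ih =>
    rw [sUnion_insert]
    exact hJ.union_mem _ _ (h (mem_insert _ _)) (ih fun A hA => h (mem_insert_of_mem _ hA))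

theorem mem_generatedIdeal_union_iff (hJ : IsIdealOnOmega J) {H : Set (Set ℕ)} {A : Set ℕ} :
    A ∈ generatedIdeal (J ∪ H) ↔
      ∃ F : Set (Set ℕ), F.Finite ∧ F ⊆ H ∧ A \ ⋃₀ F ∈ J := by
  constructor
  · rintro ⟨F, hF, hFH, hA⟩
    refine ⟨F ∩ H, hF.inter_of_left _, inter_subset_right, ?_⟩
    refine hJ.subset_mem _ _ ?_ (hJ.union_mem _ _ (hJ.fin_mem _ hA)
      (hJ.sUnion_mem (hF.inter_of_left J) inter_subset_right))
    rintro m ⟨hm, hmF⟩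
    by_cases h : m ∈ ⋃₀ F
    · obtain ⟨B, hB, hmB⟩ := h
      rcases hFH hB with h | h
      · exact Or.inr ⟨B, ⟨hB, h⟩, hmB⟩
      · exact absurd ⟨B, ⟨hB, h⟩, hmB⟩ hmF
    · exact Or.inl ⟨hm, h⟩
  · rintro ⟨F, hF, hFH, hA⟩
    refine ⟨insert (A \ ⋃₀ F) F, hF.insert _,
      insert_subset (Or.inl hA) (hFH.trans subset_union_right), ?_⟩
    rw [sUnion_insert, ← sdiff_sdiff, sdiff_sdiff_right_self]
    convert finite_empty (α := ℕ)
    ext m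
    simp only [mem_sdiff, mem_inter_iff, mem_empty_iff_false, iff_false]
    tauto

variable {𝒜 H : Set (Set ℕ)}

theorem IsPositiveADFamily.mem_generatedIdeal_iff (hJ : IsIdealOnOmega J)
    (h𝒜 : IsPositiveADFamily J 𝒜) (hH : H ⊆ 𝒜) {A : Set ℕ} (hA : A ∈ 𝒜) :
    A ∈ generatedIdeal (J ∪ H) ↔ A ∈ H := by
  refine ⟨fun h => ?_, fun h => subset_generatedIdeal _ (Or.inr h)⟩
  by_contra hAH
  obtain ⟨F, hF, hFH, hAF⟩ := (mem_generatedIdeal_union_iff hJ).1 h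
  refine h𝒜.positive A hA ?_
  rw [← inter_union_sdiff A (⋃₀ F)]
  refine hJ.union_mem _ _ (hJ.fin_mem _ ?_) hAF
  rw [sUnion_eq_biUnion, inter_iUnion₂]
  exact hF.biUnion fun B hB => h𝒜.inter_finite A hA B (hH (hFH hB))
    (by rintro rfl; exact hAH (hFH hB))

theorem IsPositiveADFamily.isIdealOnOmega_generatedIdeal (hJ : IsIdealOnOmega J)
    (h𝒜 : IsPositiveADFamily J 𝒜) (hinf : 𝒜.Infinite) (hH : H ⊆ 𝒜) :
    IsIdealOnOmega (generatedIdeal (J ∪ H)) where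
  fin_mem A hA := subset_generatedIdeal _ (Or.inl (hJ.fin_mem A hA))
  subset_mem A B hAB := by
    rintro ⟨F, hF, hFH, hB⟩
    exact ⟨F, hF, hFH, hB.subset (sdiff_subset_sdiff_left hAB)⟩
  union_mem A B := by
    rintro ⟨F, hF, hFH, hA⟩ ⟨G, hG, hGH, hB⟩
    refine ⟨F ∪ G, hF.union hG, union_subset hFH hGH, (hA.union hB).subset ?_⟩
    rw [sUnion_union]
    rintro m ⟨h | h, hm⟩
    · exact Or.inl ⟨h, fun h' => hm (Or.inl h')⟩
    · exact Or.inr ⟨h, fun h' => hm (Or.inr h')⟩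
  univ_notMem h := by
    obtain ⟨F, hF, hFH, hA⟩ := (mem_generatedIdeal_union_iff hJ).1 h
    -- If F covered ω modulo J, it would cover a member A of 𝒜 outside F, against the previous
    -- criterion applied to F in place of H.
    obtain ⟨A, hA𝒜, hAF⟩ := hinf.exists_notMem_finite hF
    refine hAF <| (h𝒜.mem_generatedIdeal_iff hJ (hFH.trans hH) hA𝒜).1 ?_
    exact (mem_generatedIdeal_union_iff hJ).2
      ⟨F, hF, subset_rfl, hJ.subset_mem _ _ (sdiff_subset_sdiff_left (subset_univ A)) hA⟩

theorem IsTall.generatedIdeal (h : IsTall J) : IsTall (generatedIdeal (J ∪ H)) := fun X hX => by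
  obtain ⟨A, hA, hAX⟩ := h X hX
  exact ⟨A, subset_generatedIdeal _ (Or.inl hA), hAX⟩

/-- Membership in the ideal generated by a subfamily of an almost disjoint family is decided by
membership in the ideal generated by the whole family and by the members of the family that meet
the given set in a positive set. -/
theorem IsPositiveADFamily.mem_generatedIdeal_iff_forall (hJ : IsIdealOnOmega J)
    (h𝒜 : IsPositiveADFamily J 𝒜) (hH : H ⊆ 𝒜) {X : Set ℕ} :
    X ∈ generatedIdeal (J ∪ H) ↔
      X ∈ generatedIdeal (J ∪ 𝒜) ∧ ∀ A ∈ 𝒜, A ∩ X ∈ J ∨ A ∈ H := by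
  simp only [mem_generatedIdeal_union_iff hJ]
  constructor
  · rintro ⟨F, hF, hFH, hX⟩
    refine ⟨⟨F, hF, hFH.trans hH, hX⟩, fun A hA => or_iff_not_imp_right.2 fun hAH => ?_⟩
    rw [← inter_union_sdiff (A ∩ X) (⋃₀ F)]
    refine hJ.union_mem _ _ (hJ.fin_mem _ ?_)
      (hJ.subset_mem _ _ (sdiff_subset_sdiff_left inter_subset_right) hX)
    rw [sUnion_eq_biUnion, inter_iUnion₂]
    exact hF.biUnion fun B hB => (h𝒜.inter_finite A hA B (hH (hFH hB))
      (by rintro rfl; exact hAH (hFH hB))).subset (inter_subset_inter_left _ inter_subset_left)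
  · rintro ⟨⟨F, hF, hF𝒜, hX⟩, h⟩
    refine ⟨F ∩ H, hF.inter_of_left _, inter_subset_right, ?_⟩
    -- Members of F outside H cover only a J-small part of X, so they can be dropped.
    have hJ' : ⋃₀ ((fun A => A ∩ X) '' (F \ H)) ∈ J := by
      refine hJ.sUnion_mem (hF.sdiff.image _) ?_
      rintro _ ⟨A, hA, rfl⟩
      exact (h A (hF𝒜 hA.1)).resolve_right hA.2
    refine hJ.subset_mem _ _ ?_ (hJ.union_mem _ _ hX hJ')
    rintro m ⟨hmX, hm⟩
    by_cases hmF : m ∈ ⋃₀ F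
    · obtain ⟨A, hA, hmA⟩ := hmF
      exact Or.inr ⟨_, ⟨A, ⟨hA, fun hAH => hm ⟨A, ⟨hA, hAH⟩, hmA⟩⟩, rfl⟩, hmA, hmX⟩
    · exact Or.inl ⟨hmX, hmF⟩

/-- Parametrized form of `mem_generatedIdeal_union_iff`. -/
theorem mem_generatedIdeal_image_iff (hJ : IsIdealOnOmega J) {C : Type} (a : C → Set ℕ)
    {B : Set C} {X : Set ℕ} :
    X ∈ generatedIdeal (J ∪ a '' B) ↔
      ∃ (k : ℕ) (v : Fin k → C), (∀ i, v i ∈ B) ∧ X \ ⋃ i, a (v i) ∈ J := by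
  rw [mem_generatedIdeal_union_iff hJ]
  constructor
  · rintro ⟨F, hF, hFB, hX⟩
    obtain ⟨k, u, hu⟩ : ∃ (k : ℕ) (u : Fin k → Set ℕ), range u = F := by
      have := hF.to_subtype
      obtain ⟨k, ⟨e⟩⟩ := Finite.exists_equiv_fin F
      exact ⟨k, fun i => e.symm i,
        (e.symm.surjective.range_comp Subtype.val).trans Subtype.range_val⟩
    have : ∀ i, ∃ c ∈ B, a c = u i := fun i => hFB (hu ▸ mem_range_self i)
    choose v hvB hv using this
    refine ⟨k, v, hvB, ?_⟩
    rwa [← hu, sUnion_range, ← funext hv] at hX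
  · rintro ⟨k, v, hv, hX⟩
    refine ⟨range fun i => a (v i), finite_range _, ?_, by rwa [sUnion_range]⟩
    rintro _ ⟨i, rfl⟩
    exact ⟨_, hv i, rfl⟩

end GeneratedIdeal

/-! ### Projective upper bounds for generated ideals. -/

section Definability

variable {w : ℕ → ℝ} {C : Type} [TopologicalSpace C] {a : C → Set ℕ}

theorem continuous_diff_iUnion (ha : Continuous a) (k : ℕ) :
    Continuous fun p : Set ℕ × (Fin k → C) => p.1 \ ⋃ i, a (p.2 i) := by
  refine continuous_powerSet_iff.2 fun m => ?_
  have h : IsClopen (⋃ i, {p : Set ℕ × (Fin k → C) | m ∈ a (p.2 i)}) :=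
    isClopen_iUnion_of_finite fun i => (continuous_powerSet_iff.1 ha m).preimage
      (f := fun p : Set ℕ × (Fin k → C) => p.2 i) (by fun_prop)
  convert ((isClopen_setOf_mem m).preimage
    (continuous_fst : Continuous (Prod.fst : Set ℕ × (Fin k → C) → Set ℕ))).diff h using 1
  ext p
  simp

theorem isSigmaOne_generatedIdeal {n : ℕ} [PolishSpace C] (ha : Continuous a)
    (hw : ∀ m, 0 ≤ w m) (huniv : univ ∉ summableIdeal w) {B : Set C}
    (hB : IsSigmaOne (n + 1) B) :
    IsSigmaOne (n + 1) (generatedIdeal (summableIdeal w ∪ a '' B)) := by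
  have : generatedIdeal (summableIdeal w ∪ a '' B) = ⋃ k : ℕ, Prod.fst ''
      ((fun p : Set ℕ × (Fin k → C) => p.1 \ ⋃ i, a (p.2 i)) ⁻¹' summableIdeal w ∩
        ⋂ i : ℕ, {p | ∀ h : i < k, p.2 ⟨i, h⟩ ∈ B}) := by
    ext X
    rw [mem_generatedIdeal_image_iff (isIdealOnOmega_summableIdeal hw huniv)]
    simp only [mem_iUnion, mem_image, Prod.exists, exists_and_right, exists_eq_right,
      mem_inter_iff, mem_preimage, mem_iInter, mem_ofPred_eq]
    refine exists_congr fun k => exists_congr fun v => ?_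
    rw [and_comm, Fin.forall_iff]
  rw [this]
  refine IsSigmaOne.iUnion fun k => IsSigmaOne.image_fst (IsSigmaOne.inter ?_ ?_)
  · exact ((isBorel_summableIdeal hw).isSigmaOne _).preimage (continuous_diff_iUnion ha k)
  · refine IsSigmaOne.iInter fun i => ?_
    -- The finite conjunction was written as an intersection over ℕ; indices i ≥ k impose no
    -- condition.
    by_cases h : i < k
    · simp only [h, forall_true_left]
      exact hB.preimage (f := fun p : Set ℕ × (Fin k → C) => p.2 ⟨i, h⟩) (by fun_prop)
    · simp only [h, IsEmpty.forall_iff]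
      exact (isClosed_univ.isBorel).isSigmaOne _

/-- Projection along the compact space `Fin k → C` is closed, so the ideal is F_σ. -/
theorem isBorel_generatedIdeal_range [CompactSpace C] (ha : Continuous a)
    (hw : ∀ m, 0 ≤ w m) (huniv : univ ∉ summableIdeal w) :
    IsBorel (generatedIdeal (summableIdeal w ∪ range a)) := by
  have : generatedIdeal (summableIdeal w ∪ range a) = ⋃ (k : ℕ) (N : ℕ), Prod.fst ''
      ((fun p : Set ℕ × (Fin k → C) => p.1 \ ⋃ i, a (p.2 i)) ⁻¹' boundedWeight w N) := by
    ext X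
    rw [← image_univ, mem_generatedIdeal_image_iff (isIdealOnOmega_summableIdeal hw huniv),
      summableIdeal_eq_iUnion hw]
    simp only [mem_univ, implies_true, true_and, mem_iUnion, mem_image, Prod.exists,
      exists_and_right, exists_eq_right, mem_preimage]
    exact exists_congr fun k => exists_comm
  rw [this]
  exact IsBorel.iUnion fun k => IsBorel.iUnion fun N => IsClosed.isBorel <|
    isClosedMap_fst_of_compactSpace _
      ((isClosed_boundedWeight w N).preimage (continuous_diff_iUnion ha k))

/-- The defining existential quantifier over members of B would cost a level. By the universal
description, the complement is instead a Borel set together with a projection of a Σ set. -/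
theorem isPiOne_generatedIdeal {n : ℕ} [PolishSpace C] [CompactSpace C] (ha : Continuous a)
    (hinj : Function.Injective a) (hw : ∀ m, 0 ≤ w m)
    (huniv : univ ∉ summableIdeal w) (h𝒜 : IsPositiveADFamily (summableIdeal w) (range a))
    {B : Set C} (hB : IsPiOne (n + 1) B) :
    IsPiOne (n + 1) (generatedIdeal (summableIdeal w ∪ a '' B)) := by
  have hcont : Continuous fun p : Set ℕ × C => a p.2 ∩ p.1 :=
    continuous_powerSet_iff.2 fun m =>
      ((continuous_powerSet_iff.1 ha m).preimage continuous_snd).inter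
        ((isClopen_setOf_mem m).preimage continuous_fst)
  have : (generatedIdeal (summableIdeal w ∪ a '' B))ᶜ =
      (generatedIdeal (summableIdeal w ∪ range a))ᶜ ∪ Prod.fst ''
        ((fun p : Set ℕ × C => a p.2 ∩ p.1) ⁻¹' (summableIdeal w)ᶜ ∩ Prod.snd ⁻¹' Bᶜ) := by
    ext X
    rw [mem_compl_iff, h𝒜.mem_generatedIdeal_iff_forall (isIdealOnOmega_summableIdeal hw huniv)
      (image_subset_range _ _)]
    simp only [forall_mem_range, hinj.mem_set_image]
    simp only [not_and_or, not_forall, not_or, mem_union, mem_compl_iff, mem_image, mem_inter_iff,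
      mem_preimage, Prod.exists, exists_and_right, exists_eq_right]
  rw [IsPiOne, this]
  refine IsSigmaOne.union ((isBorel_generatedIdeal_range ha hw huniv).compl.isSigmaOne _)
    (IsSigmaOne.image_fst (IsSigmaOne.inter ?_ (IsSigmaOne.preimage hB continuous_snd)))
  exact ((isBorel_summableIdeal hw).compl.isSigmaOne _).preimage hcont

end Definability

/-! ### Branches of the binary tree and the final construction. -/

section Branches

/-- A natural number `m ≥ 1` codes the finite binary sequence of its binary digits except for the
leading one. `branchSet x` is the set of codes of initial segments of `x` (and `0`). -/
def branchSet (x : ℕ → Bool) : Set ℕ := {m | ∀ i < Nat.log 2 m, m.testBit i = x i}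

/-- The weight of a code is the inverse of the length of the extended sequence. -/
noncomputable def branchWeight (m : ℕ) : ℝ := 1 / ((Nat.log 2 m : ℝ) + 1)

theorem branchWeight_nonneg (m : ℕ) : 0 ≤ branchWeight m := by
  unfold branchWeight
  positivity

theorem tendsto_branchWeight : Filter.Tendsto branchWeight Filter.atTop (𝓝 0) := by
  have h : Filter.Tendsto (Nat.log 2) Filter.atTop Filter.atTop :=
    Filter.tendsto_atTop.2 fun k => Filter.eventually_atTop.2
      ⟨2 ^ k, fun m hm => Nat.le_log_of_pow_le one_lt_two hm⟩
  exact tendsto_one_div_add_atTop_nhds_zero_nat.comp h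

theorem exists_mem_branchSet_log_eq (x : ℕ → Bool) (n : ℕ) :
    ∃ m ∈ branchSet x, Nat.log 2 m = n := by
  have hlt := Nat.ofBits_lt_two_pow fun i : Fin n => x i
  -- The summand 2 ^ n is the leading digit, which marks the length n.
  have hlog : Nat.log 2 (2 ^ n + Nat.ofBits fun i : Fin n => x i) = n :=
    Nat.log_eq_of_pow_le_of_lt_pow (by omega) (by rw [pow_succ]; omega)
  refine ⟨_, fun i hi => ?_, hlog⟩
  rw [hlog] at hi
  rw [Nat.testBit_two_pow_add_gt hi, Nat.testBit_ofBits_lt _ _ hi]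

theorem branchSet_notMem_summableIdeal (x : ℕ → Bool) :
    branchSet x ∉ summableIdeal branchWeight := by
  intro h
  choose c hc hlog using exists_mem_branchSet_log_eq x
  have hinj : Function.Injective c := Function.LeftInverse.injective hlog
  have h' := Summable.comp_injective h hinj
  -- One node per level n contributes 1/(n + 1), hence the shift by one.
  refine Real.not_summable_one_div_natCast ((summable_nat_add_iff 1).1 (h'.congr fun n => ?_))
  simp [hc n, branchWeight, hlog]

theorem univ_notMem_summableIdeal_branchWeight : univ ∉ summableIdeal branchWeight := fun h =>
  branchSet_notMem_summableIdeal (fun _ => false)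
    (summableIdeal_mono branchWeight_nonneg (subset_univ _) h)

theorem branchSet_inter_finite {x y : ℕ → Bool} (h : x ≠ y) :
    (branchSet x ∩ branchSet y).Finite := by
  obtain ⟨i, hi⟩ := Function.ne_iff.1 h
  refine (finite_lt_nat (2 ^ (i + 1))).subset fun m hm => ?_
  by_contra hlt
  have hlog : i < Nat.log 2 m := Nat.le_log_of_pow_le one_lt_two (not_lt.1 hlt)
  exact hi ((hm.1 i hlog).symm.trans (hm.2 i hlog))

/-- Equal branches from distinct points would be finite by almost disjointness, hence summable. -/
theorem branchSet_injective : Function.Injective branchSet := by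
  intro x y h
  by_contra hne
  refine branchSet_notMem_summableIdeal x (summableIdeal_of_finite ?_)
  simpa [← h] using branchSet_inter_finite hne

theorem continuous_branchSet : Continuous branchSet := by
  refine continuous_powerSet_iff.2 fun m => ?_
  have : {x | m ∈ branchSet x} =
      ⋂ i ∈ Finset.range (Nat.log 2 m), {x : ℕ → Bool | m.testBit i = x i} := by
    ext x
    simp [branchSet]
  rw [this]
  refine isClopen_biInter_finset fun i _ => ?_
  exact (isClopen_discrete {b | m.testBit i = b}).preimage (continuous_apply (A := fun _ => Bool) i)

theorem isPositiveADFamily_branchSet :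
    IsPositiveADFamily (summableIdeal branchWeight) (range branchSet) where
  nonempty := range_nonempty _
  positive := forall_mem_range.2 branchSet_notMem_summableIdeal
  inter_finite := by
    rintro _ ⟨x, rfl⟩ _ ⟨y, rfl⟩ h
    exact branchSet_inter_finite fun hxy => h (congrArg _ hxy)

theorem accPt_cantor (x : ℕ → Bool) : AccPt x (Filter.principal univ) := by
  rw [accPt_iff_frequently]
  -- Flipping the n-th digit gives points different from x that converge to x.
  have h : Filter.Tendsto (fun n => Function.update x n (!x n)) Filter.atTop (𝓝 x) := by
    refine tendsto_pi_nhds.2 fun i => tendsto_const_nhds.congr' ?_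
    filter_upwards [Filter.eventually_gt_atTop i] with n hn
    rw [Function.update_of_ne hn.ne]
  refine h.frequently (Filter.Frequently.of_forall fun n => ⟨fun hx => ?_, mem_univ _⟩)
  simpa using congrFun hx n

theorem perfect_range_branchSet : Perfect (range branchSet) := by
  refine ⟨(isCompact_range continuous_branchSet).isClosed, ?_⟩
  rintro _ ⟨x, rfl⟩
  have := (accPt_cantor x).map continuous_branchSet.continuousAt branchSet_injective
  rwa [Filter.map_principal, image_univ] at this

/-- The branches, indexed by Cantor space. -/
noncomputable def branchHomeomorph : (ℕ → Bool) ≃ₜ range branchSet :=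
  Continuous.homeoOfEquivCompactToT2 (f := Equiv.ofInjective branchSet branchSet_injective)
    (continuous_branchSet.subtype_mk _)

theorem val_image_branchHomeomorph (B : Set (ℕ → Bool)) :
    Subtype.val '' (branchHomeomorph.symm ⁻¹' B) = branchSet '' B := by
  rw [← branchHomeomorph.image_eq_preimage_symm, image_image]
  rfl

/-- Common to both classes: B is a continuous preimage of both ℬ and the ideal, so hardness
transfers and only `hΓ` depends on the class. -/
theorem exists_generatedIdeal_isCompleteFor
    {Γ : ∀ {X : Type} [TopologicalSpace X], Set X → Prop}
    (hpre : ∀ {X Y : Type} [TopologicalSpace X] [TopologicalSpace Y] {s : Set Y}, Γ s →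
      ∀ {f : X → Y}, Continuous f → Γ (f ⁻¹' s))
    {B : Set (ℕ → Bool)} (hB : IsCompleteFor Γ B)
    (hΓ : Γ (generatedIdeal (summableIdeal branchWeight ∪ branchSet '' B))) :
    ∃ (J 𝒜 : Set (Set ℕ)) (ℬ : Set 𝒜),
      IsIdealOnOmega J ∧ IsTall J ∧ IsBorel J ∧
      IsPositiveADFamily J 𝒜 ∧ Perfect 𝒜 ∧
      IsCompleteFor Γ ℬ ∧
      IsIdealOnOmega (generatedIdeal (J ∪ Subtype.val '' ℬ)) ∧
      IsTall (generatedIdeal (J ∪ Subtype.val '' ℬ)) ∧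
      IsCompleteFor Γ (generatedIdeal (J ∪ Subtype.val '' ℬ)) := by
  have hJ := isIdealOnOmega_summableIdeal branchWeight_nonneg
    univ_notMem_summableIdeal_branchWeight
  have htall := isTall_summableIdeal branchWeight_nonneg tendsto_branchWeight
  refine ⟨summableIdeal branchWeight, range branchSet, branchHomeomorph.symm ⁻¹' B, hJ, htall,
    isBorel_summableIdeal branchWeight_nonneg, isPositiveADFamily_branchSet,
    perfect_range_branchSet,
    ⟨hpre hB.1 (Homeomorph.continuous _), hB.2.of_preimage branchHomeomorph.continuous ?_⟩, ?_⟩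
  · ext x
    simp
  rw [val_image_branchHomeomorph]
  refine ⟨isPositiveADFamily_branchSet.isIdealOnOmega_generatedIdeal hJ
    (infinite_range_of_injective branchSet_injective) (image_subset_range _ _),
    htall.generatedIdeal, hΓ, hB.2.of_preimage continuous_branchSet ?_⟩
  ext x
  rw [mem_preimage, isPositiveADFamily_branchSet.mem_generatedIdeal_iff hJ
    (image_subset_range _ _) (mem_range_self x), branchSet_injective.mem_set_image]

end Branches

theorem theorem3p6 (n : ℕ) (hn : 1 ≤ n) :
    (∃ (J 𝒜 : Set (Set ℕ)) (ℬ : Set 𝒜),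
      IsIdealOnOmega J ∧ IsTall J ∧ IsBorel J ∧
      IsPositiveADFamily J 𝒜 ∧ Perfect 𝒜 ∧
      IsCompleteFor (IsSigmaOne n) ℬ ∧
      IsIdealOnOmega (generatedIdeal (J ∪ Subtype.val '' ℬ)) ∧
      IsTall (generatedIdeal (J ∪ Subtype.val '' ℬ)) ∧
      IsCompleteFor (IsSigmaOne n) (generatedIdeal (J ∪ Subtype.val '' ℬ))) ∧
    (∃ (J 𝒜 : Set (Set ℕ)) (ℬ : Set 𝒜),
      IsIdealOnOmega J ∧ IsTall J ∧ IsBorel J ∧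
      IsPositiveADFamily J 𝒜 ∧ Perfect 𝒜 ∧
      IsCompleteFor (IsPiOne n) ℬ ∧
      IsIdealOnOmega (generatedIdeal (J ∪ Subtype.val '' ℬ)) ∧
      IsTall (generatedIdeal (J ∪ Subtype.val '' ℬ)) ∧
      IsCompleteFor (IsPiOne n) (generatedIdeal (J ∪ Subtype.val '' ℬ))) := by
  obtain ⟨k, rfl⟩ : ∃ k, n = k + 1 := ⟨n - 1, by omega⟩
  obtain ⟨B, hB⟩ := exists_isCompleteFor_isSigmaOne k
  exact ⟨exists_generatedIdeal_isCompleteFor (Γ := IsSigmaOne (k + 1)) IsSigmaOne.preimage hB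
      (isSigmaOne_generatedIdeal continuous_branchSet branchWeight_nonneg
        univ_notMem_summableIdeal_branchWeight hB.1),
    exists_generatedIdeal_isCompleteFor (Γ := IsPiOne (k + 1)) IsPiOne.preimage hB.compl
      (isPiOne_generatedIdeal continuous_branchSet branchSet_injective branchWeight_nonneg
        univ_notMem_summableIdeal_branchWeight isPositiveADFamily_branchSet hB.compl.1)⟩
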